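/- Let $\gamma:[0,\infty)\to[\varepsilon,1-\varepsilon]$, for some $\varepsilon>0$, be Lipschitz-continuous and strictly increasing. Let $(T_n)_{n\ge 1}$ be i.i.d. uniform on $[0,1]$, let $(Y_n)_{n\ge1}$ be i.i.d. exponential with parameter $1$, the two sequences being independent, and put $Z_n=Y_1+\dots+Y_n$. Let $N=\sum_{n\ge1}\delta_{(T_n,Z_n)}$, which is a Poisson measure on $[0,1]\times[0,\infty)$ with intensity $dt\,dz$, and let $\mathcal F_t=\sigma(N(A): A\subset[0,t]\times[0,\infty)\text{ Borel})$. Let $M=(M_t)_{t\in[0,1]}$ be a càdlàg $(\mathcal F_t)$-adapted solution of $$M_t=\int_{(0,t]}\int_{[0,\infty)}(1+z)^{-1/\gamma(M_{s-})}\,N(ds,dz),\qquad t\in[0,1],$$ and let $\mathcal J=\{t\in(0,1]: M_t\neq M_{t-}\}$ be its set of jump times. For $f:[0,1]\to\mathbb R$, $t_0\in[0,1]$ and $\alpha>0$, write $f\in C^\alpha(t_0)$ if there are $C>0$ and a polynomial $p$ of degree less than $\alpha$ such that $|f(t)-p(t)|\le C|t-t_0|^\alpha$ for all $t$ in a neighbourhood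 of $t_0$ in $[0,1]$, and let $h_f(t_0)=\sup\{\alpha>0: f\in C^\alpha(t_0)\}\in[0,\infty]$ (with $\sup\emptyset=0$). For $t\in[0,1]$ let $$\delta_t=\sup\bigl\{\delta\ge1:\ |t-T_n|<(1+Z_n)^{-\delta}\text{ for infinitely many } n\bigr\}\in[0,\infty],$$ again with $\sup\emptyset=0$. Then, almost surely, for every $t\in[0,1]\setminus\mathcal J$, $$h_M(t)=\frac{1}{\delta_t\,\gamma(M_t)}$$ (where the right-hand side is $0$ if $\delta_t=\infty$), and for every $t\in[0,1]$, $h_M(t)\le 1/\gamma(M_t)$. -/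

import Mathlib

open MeasureTheory ProbabilityTheory Filter Topology Set
open scoped unitInterval ENNReal NNReal

noncomputable section

/-- `f ∈ C^α(t₀)` for a function on `[0,1]`: near `t₀` (in `[0,1]`), `f` is within `C |t - t₀|^α` of
a polynomial of degree less than `α`. -/
def InPointwiseHolder (f : I → ℝ) (α : ℝ) (t₀ : I) : Prop :=
  ∃ C : ℝ, 0 < C ∧ ∃ p : Polynomial ℝ, (p.natDegree : ℝ) < α ∧
    ∀ᶠ t in 𝓝 t₀, |f t - p.eval (t : ℝ)| ≤ C * |(t : ℝ) - (t₀ : ℝ)| ^ α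

/-- The pointwise Hölder exponent `sup {α > 0 : f ∈ C^α(t₀)} ∈ [0,∞]`, with `sup ∅ = 0`. -/
def pointwiseHolderExponent (f : I → ℝ) (t₀ : I) : ℝ≥0∞ :=
  ⨆ α ∈ {α : ℝ | 0 < α ∧ InPointwiseHolder f α t₀}, ENNReal.ofReal α

/-- Right-continuous with left limits on `[0,1]` (the left limit at `0` is no condition, since
`𝓝[<] (0 : I) = ⊥`). -/
def IsCadlagPath (f : I → ℝ) : Prop :=
  ∀ t : I, ContinuousWithinAt f (Ici t) t ∧ ∃ l : ℝ, Tendsto f (𝓝[<] t) (𝓝 l)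

/-- The jump times of a càdlàg path. `Function.leftLim f 0 = f 0`, so `0` is never a jump time. -/
def jumpTimes (f : I → ℝ) : Set I :=
  {t | f t - Function.leftLim f t ≠ 0}

/-- The random inputs: `T₀, T₁, …` independent and uniform on `[0,1]`, `Y₀, Y₁, …` independent and
exponential of parameter `1`, and the two sequences independent of each other. -/
structure IsPoissonInput {Ω : Type*} [MeasurableSpace Ω] (P : Measure Ω)
    (T : ℕ → Ω → I) (Y : ℕ → Ω → ℝ) : Prop where
  measurable_T : ∀ n, Measurable (T n)
  measurable_Y : ∀ n, Measurable (Y n)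
  law_T : ∀ n, P.map (T n) = volume
  law_Y : ∀ n, P.map (Y n) = expMeasure 1
  indep_T : iIndepFun T P
  indep_Y : iIndepFun Y P
  indep_TY : IndepFun (fun ω n => T n ω) (fun ω n => Y n ω) P

/-- The arrival heights: the sum of the first `n + 1` exponential variables (indices start at
`0`). -/
def poissonHeight {Ω : Type*} (Y : ℕ → Ω → ℝ) (n : ℕ) (ω : Ω) : ℝ :=
  ∑ i ∈ Finset.range (n + 1), Y i ω

/-- The random point measure `N = ∑ₙ δ_(Tₙ, Zₙ)`. -/
def poissonPointMeasure {Ω : Type*} (T : ℕ → Ω → I) (Y : ℕ → Ω → ℝ) (ω : Ω) : Measure (I × ℝ) :=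
  Measure.sum fun n => Measure.dirac (T n ω, poissonHeight Y n ω)

/-- `ℱ_t = σ(N(A) : A Borel, A ⊆ [0,t] × [0,∞))`. -/
def poissonFiltration {Ω : Type*} (T : ℕ → Ω → I) (Y : ℕ → Ω → ℝ) (t : I) : MeasurableSpace Ω :=
  ⨆ A ∈ {A : Set (I × ℝ) | MeasurableSet A ∧ A ⊆ Iic t ×ˢ Ici (0 : ℝ)},
    MeasurableSpace.comap (fun ω => poissonPointMeasure T Y ω A) inferInstance

/-- `G(β,z) = (1+z)^(-1/β)`. -/
def jumpSize (β z : ℝ) : ℝ := (1 + z) ^ (-1 / β)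

/-- The standing assumption on `γ : [0,∞) → [ε, 1-ε]`: Lipschitz and strictly increasing. Only the
values of `γ` on `[0,∞)` matter. -/
def IsAdmissibleIndex (γ : ℝ → ℝ) : Prop :=
  (∃ ε : ℝ, 0 < ε ∧ MapsTo γ (Ici 0) (Icc ε (1 - ε))) ∧
    (∃ K : ℝ≥0, LipschitzOnWith K γ (Ici 0)) ∧ StrictMonoOn γ (Ici 0)

/-- `M` is a càdlàg adapted solution on `[0,1]` of
`M_t = ∫_(0,t] ∫_[0,∞) G(γ(M_(s-)), z) N(ds,dz)`. -/
structure IsJumpSDESolution {Ω : Type*} [MeasurableSpace Ω] (P : Measure Ω)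
    (T : ℕ → Ω → I) (Y : ℕ → Ω → ℝ) (γ : ℝ → ℝ) (M : I → Ω → ℝ) : Prop where
  adapted : ∀ t, Measurable[poissonFiltration T Y t] (M t)
  cadlag : ∀ᵐ ω ∂P, IsCadlagPath fun t => M t ω
  sde : ∀ᵐ ω ∂P, ∀ t : I,
    M t ω = ∫ p in Ioc 0 t ×ˢ Ici (0 : ℝ),
      jumpSize (γ (Function.leftLim (fun s => M s ω) p.1)) p.2 ∂(poissonPointMeasure T Y ω)

/-- `A_δ`: the points lying in infinitely many of the balls `B(Tₙ, (1+Zₙ)^(-δ))`. -/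
def approxSet {Ω : Type*} (T : ℕ → Ω → I) (Y : ℕ → Ω → ℝ) (ω : Ω) (δ : ℝ) : Set I :=
  ⋂ p : ℕ, ⋃ n ≥ p, Metric.ball (T n ω) ((1 + poissonHeight Y n ω) ^ (-δ))

/-- The approximation rate `δ_t = sup {δ ≥ 1 : t ∈ A_δ} ∈ [0,∞]`; the value `∞` does occur. -/
def approxRate {Ω : Type*} (T : ℕ → Ω → I) (Y : ℕ → Ω → ℝ) (ω : Ω) (t : I) : ℝ≥0∞ :=
  ⨆ δ ∈ {δ : ℝ | 1 ≤ δ ∧ t ∈ approxSet T Y ω δ}, ENNReal.ofReal δ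

end

/-! Almost surely `M` is the nondecreasing sum of its jumps `(1+Zₙ)^(-1/γ(M_(Tₙ-)))`, and `Zₙ ~ n`
by the law of large numbers. Near a continuity point `t`, `γ` of the left limits is close to
`γ(M_t)`, so the jumps there have size `(1+Zₙ)^(-1/γ(M_t))` up to an arbitrarily small change of
exponent. What remains is how fast the `Tₙ` approach `t`.

Upper bound (`InPointwiseHolder.mul_le_inv_index`): polynomials are continuous, so `C^α` regularity
at `t` forces the jump at `s` to be `O(|s - t|^α)`. Infinitely many `Tₙ` within `(1+Zₙ)^(-δ)` of `t`
then give `αδ ≤ 1/γ(M_t)`.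

Lower bound (`inPointwiseHolder_of_lt`): if `δ > δ_t`, late points stay at distance at least
`(1+Zₙ)^(-δ)` from `t`, so only indices `n` of order at least `d^(-1/δ)` jump within distance `d` of
`t`. A Chernoff bound over a grid of windows and Borel–Cantelli
(`IsPoissonInput.ae_hasUniformJumpControl`) bound the mass of these jumps in all windows at once.
This control concerns deterministic powers of `n + 1`, not `M`, so its null set depends neither on
`t` nor on the solution.

Finally `δ_t ≥ 1` for all `t` simultaneously, by a covering argument
(`IsPoissonInput.ae_forall_frequently_dist_lt`). This yields the bound `1/γ(M_t)` off the jumps; at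
a jump no `α > 0` is admissible. -/

/-! ### Pure jump functions on the unit interval -/

section JumpSeries

variable {f : I → ℝ} {τ : ℕ → I} {J : ℕ → ℝ}

/-- `f` is the pure jump function with jump `J n` at time `τ n`. -/
def IsJumpSeries (f : I → ℝ) (τ : ℕ → I) (J : ℕ → ℝ) : Prop :=
  ∀ t, HasSum (fun n => (Ioc (0 : I) t).indicator (fun _ => J n) (τ n)) (f t)

lemma IsJumpSeries.hasSum_sub (hf : IsJumpSeries f τ J) {u v : I} (huv : u ≤ v) :
    HasSum (fun n => (Ioc u v).indicator (fun _ => J n) (τ n)) (f v - f u) := by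
  refine ((hf v).sub (hf u)).congr_fun fun n => ?_
  have h0 : (0 : I) ≤ u := bot_le
  by_cases h1 : 0 < τ n <;> by_cases h2 : τ n ≤ u <;> by_cases h3 : τ n ≤ v <;>
    simp [indicator, h1, h2, h3, not_lt.2, not_le.1] <;> grind

lemma IsJumpSeries.monotone (hf : IsJumpSeries f τ J) (hJ : ∀ n, 0 ≤ J n) : Monotone f := by
  intro u v huv
  rw [← sub_nonneg]
  exact (hf.hasSum_sub huv).nonneg fun n => indicator_nonneg (fun _ _ => hJ n) _

/-- Every increment `f (τ n) - f u` with `u < τ n` contains the term `J n`; let `u` increase to `τ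
n`. Equality may fail because several indices can share a time. -/
lemma IsJumpSeries.leftLim_add_le (hf : IsJumpSeries f τ J) (hJ : ∀ n, 0 ≤ J n) {n : ℕ}
    (hn : τ n ≠ 0) : Function.leftLim f (τ n) + J n ≤ f (τ n) := by
  have hpos : 0 < τ n := unitInterval.pos_iff_ne_zero.2 hn
  have : (𝓝[<] τ n).NeBot := nhdsLT_neBot_of_exists_lt ⟨0, hpos⟩
  rw [← le_sub_iff_add_le]
  refine le_of_tendsto ((hf.monotone hJ).tendsto_leftLim (τ n)) ?_
  filter_upwards [self_mem_nhdsWithin] with u hu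
  have h := le_hasSum (hf.hasSum_sub (le_of_lt hu)) n
    fun k _ => indicator_nonneg (fun _ _ => hJ k) _
  have hmem : τ n ∈ Ioc u (τ n) := ⟨hu, le_rfl⟩
  rw [indicator_of_mem hmem] at h
  linarith

/-- A jump of a function close to a polynomial near `t` is controlled by the distance to `t`. -/
lemma InPointwiseHolder.exists_sub_leftLim_le (hf : Monotone f) {α : ℝ} (hα : 0 < α) {t : I}
    (h : InPointwiseHolder f α t) :
    ∃ C : ℝ, ∀ᶠ s in 𝓝 t, f s - Function.leftLim f s ≤ C * |(s : ℝ) - t| ^ α := by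
  obtain ⟨C, hC, p, -, hp⟩ := h
  -- The estimate at `s` and its left limit at `s` involve the same value `p(s)`, which cancels;
  -- each contributes one `C`.
  refine ⟨2 * C, ?_⟩
  filter_upwards [eventually_eventually_nhds.2 hp] with s hs
  rcases eq_or_neBot (𝓝[<] s) with hbot | hne
  · rw [leftLim_eq_of_eq_bot f hbot, sub_self]
    positivity
  have hs0 := hs.self_of_nhds
  have hpc : Tendsto (fun u : I => p.eval (u : ℝ)) (𝓝[<] s) (𝓝 (p.eval (s : ℝ))) :=
    ((p.continuous.comp continuous_subtype_val).tendsto s).mono_left nhdsWithin_le_nhds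
  have hrc : Tendsto (fun u : I => C * |(u : ℝ) - t| ^ α) (𝓝[<] s) (𝓝 (C * |(s : ℝ) - t| ^ α)) := by
    refine Tendsto.mono_left (Continuous.tendsto ?_ s) nhdsWithin_le_nhds
    refine continuous_const.mul (Continuous.rpow_const (by fun_prop) fun _ => Or.inr hα.le)
  have hl := le_of_tendsto_of_tendsto ((hf.tendsto_leftLim s).sub hpc).abs hrc
    (hs.filter_mono nhdsWithin_le_nhds)
  have h1 := (abs_le.1 hs0).2
  have h2 := (abs_le.1 hl).1
  linarith

lemma InPointwiseHolder.notMem_jumpTimes (hf : Monotone f) {α : ℝ} (hα : 0 < α) {t : I}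
    (h : InPointwiseHolder f α t) : t ∉ jumpTimes f := by
  obtain ⟨C, hC⟩ := h.exists_sub_leftLim_le hf hα
  have h1 := hC.self_of_nhds
  rw [sub_self, abs_zero, Real.zero_rpow hα.ne', mul_zero] at h1
  have h2 := hf.leftLim_le (le_refl t)
  simp only [jumpTimes, mem_ofPred_eq, not_not]
  linarith

lemma continuousAt_of_notMem_jumpTimes (hf : Monotone f) {t : I}
    (hr : ContinuousWithinAt f (Ici t) t) (ht : t ∉ jumpTimes f) : ContinuousAt f t := by
  rw [jumpTimes, mem_ofPred_eq, not_not, sub_eq_zero] at ht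
  rw [continuousAt_iff_continuous_left'_right']
  refine ⟨?_, hr.mono Ioi_subset_Ici_self⟩
  rw [hf.continuousWithinAt_Iio_iff_leftLim_eq, ht]

/-- The size of a jump is governed by the left limit at the jump time, so continuity at `t` has to
be passed on to left limits at nearby points. -/
lemma tendsto_leftLim_of_continuousAt (hf : Monotone f) {t : I} (ht : ContinuousAt f t) :
    Tendsto (Function.leftLim f) (𝓝 t) (𝓝 (f t)) := by
  refine Metric.tendsto_nhds.2 fun ε hε => ?_
  have h := Metric.tendsto_nhds.1 ht (ε / 2) (half_pos hε)
  filter_upwards [eventually_eventually_nhds.2 h] with s hs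
  rcases eq_or_neBot (𝓝[<] s) with hbot | hne
  · rw [leftLim_eq_of_eq_bot f hbot]
    linarith [hs.self_of_nhds]
  · have : dist (Function.leftLim f s) (f t) ≤ ε / 2 :=
      le_of_tendsto ((hf.tendsto_leftLim s).dist tendsto_const_nhds)
        ((hs.filter_mono nhdsWithin_le_nhds).mono fun _ h => h.le)
    linarith

end JumpSeries

/-! ### Comparison of powers -/

/-- Exchanges `1 + Zₙ` and `n + 1`, in either direction, at the price of an arbitrarily small loss
in the exponent: `y ^ (b - a)` absorbs the constant. -/
lemma eventually_rpow_le_rpow_of_linear_bound {x y : ℕ → ℝ} {c a b : ℝ} (hx : ∀ n, 0 ≤ x n)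
    (hy : Tendsto y atTop atTop) (hxy : ∀ᶠ n in atTop, x n ≤ c * y n) (ha : 0 ≤ a) (hab : a < b) :
    ∀ᶠ n in atTop, x n ^ a ≤ y n ^ b := by
  have hlim : Tendsto (fun n => y n ^ (b - a)) atTop atTop :=
    (tendsto_rpow_atTop (sub_pos.2 hab)).comp hy
  filter_upwards [hxy, hlim.eventually_ge_atTop (|c| ^ a), hy.eventually_gt_atTop 0]
    with n h1 h2 h3
  calc x n ^ a ≤ (|c| * y n) ^ a :=
        Real.rpow_le_rpow (hx n) (h1.trans (by gcongr; exact le_abs_self c)) ha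
    _ = |c| ^ a * y n ^ a := Real.mul_rpow (abs_nonneg _) h3.le
    _ ≤ y n ^ (b - a) * y n ^ a := by gcongr
    _ = y n ^ b := by rw [← Real.rpow_add h3]; ring_nf

lemma tendsto_natCast_add_one_atTop : Tendsto (fun n : ℕ => (n : ℝ) + 1) atTop atTop :=
  tendsto_atTop_add_const_right _ _ tendsto_natCast_atTop_atTop

/-! ### Local regularity of a jump series -/

/-- The mass of the late jumps in every window of width `2 / m` is small, for all large `m`. -/
def HasUniformJumpControl (τ : ℕ → I) (q β η : ℝ) : Prop :=
  ∀ᶠ m : ℕ in atTop, ∀ k ≤ m, ∀ N : ℕ,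
    ∑ n ∈ Finset.range N, {n : ℕ | (m : ℝ) ^ q ≤ n + 1 ∧
        (τ n : ℝ) ∈ Icc ((k : ℝ) / m) ((k + 2) / m)}.indicator
          (fun n => ((n : ℝ) + 1) ^ (-(β + η))) n ≤
      3 * Real.log m * (m : ℝ) ^ (-(β * q))

/-- At distance `d` from `t`, take `m = ⌊1/d⌋`. The interval between `s` and `t` fits into one grid
window, and `hfar` forces every index jumping in it to satisfy `n + 1 ≥ m ^ q`. The control then
applies, and `α < β * q` leaves room for the logarithm. -/
lemma HasUniformJumpControl.exists_abs_sub_le {f : I → ℝ} {τ : ℕ → I} {J : ℕ → ℝ}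
    {q β η α : ℝ} (hctrl : HasUniformJumpControl τ q β η) (hf : IsJumpSeries f τ J)
    (hJ : ∀ n, 0 ≤ J n) (hq : 0 < q) (hα : 0 < α) (hαβ : α < β * q) {t : I} (hne : ∀ n, τ n ≠ t)
    (hfar : ∀ᶠ n : ℕ in atTop, ((n : ℝ) + 1) ^ (-q⁻¹) ≤ |(τ n : ℝ) - t|) {U : Set I}
    (hU : U ∈ 𝓝 t) (hsize : ∀ᶠ n : ℕ in atTop, τ n ∈ U → J n ≤ ((n : ℝ) + 1) ^ (-(β + η))) :
    ∃ C : ℝ, 0 < C ∧ ∀ᶠ s in 𝓝 t, |f s - f t| ≤ C * |(s : ℝ) - t| ^ α := by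
  obtain ⟨n₁, hn₁⟩ := eventually_atTop.1 (hfar.and hsize)
  -- The finitely many indices not covered by `hfar` and `hsize` are excluded by shrinking the
  -- neighbourhood.
  have havoid : ∀ᶠ s in 𝓝 t, ∀ n < n₁, τ n ≠ s := by
    have : ∀ᶠ s in 𝓝 t, ∀ n ∈ Iio n₁, τ n ≠ s := by
      rw [eventually_all_finite (finite_Iio n₁)]
      intro n _
      filter_upwards [isOpen_ne.mem_nhds (hne n).symm] with s hs using Ne.symm hs
    exact this
  obtain ⟨r, hr, hball⟩ := Metric.mem_nhds_iff.1 (inter_mem hU havoid)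
  have hlog : ∀ᶠ m : ℕ in atTop, 3 * Real.log m * (m : ℝ) ^ (-(β * q)) ≤ (m : ℝ) ^ (-α) := by
    have h1 := (isLittleO_log_rpow_atTop (sub_pos.2 hαβ)).def (by norm_num : (0 : ℝ) < 1 / 3)
    filter_upwards [tendsto_natCast_atTop_atTop.eventually h1, eventually_ge_atTop 1] with m h2 hm
    have hm' : (0 : ℝ) < m := by exact_mod_cast hm
    rw [Real.norm_of_nonneg (Real.log_natCast_nonneg m),
      Real.norm_of_nonneg (Real.rpow_nonneg hm'.le _)] at h2
    calc 3 * Real.log m * (m : ℝ) ^ (-(β * q))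
        ≤ (m : ℝ) ^ (β * q - α) * (m : ℝ) ^ (-(β * q)) := by gcongr; linarith
      _ = (m : ℝ) ^ (-α) := by rw [← Real.rpow_add hm']; ring_nf
  obtain ⟨m₀, hm₀⟩ := eventually_atTop.1 (hctrl.and hlog)
  refine ⟨2 ^ α, by positivity, ?_⟩
  filter_upwards [Metric.ball_mem_nhds t hr,
    Metric.ball_mem_nhds t (by positivity : (0 : ℝ) < 1 / (m₀ + 1))] with s hs hs'
  rcases eq_or_ne s t with rfl | hst
  · simp [Real.zero_rpow hα.ne']
  set d : ℝ := |(s : ℝ) - t| with hd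
  have hd0 : 0 < d := abs_pos.2 (sub_ne_zero.2 fun h => hst (Subtype.ext h))
  have hd1 : d ≤ 1 := by
    rw [hd, abs_le]
    constructor <;> linarith [s.2.1, s.2.2, t.2.1, t.2.2]
  have hs'' : d < 1 / (m₀ + 1) := hs'
  set m : ℕ := ⌊1 / d⌋₊ with hm
  have hm_le : (m : ℝ) ≤ 1 / d := Nat.floor_le (by positivity)
  have hm_lt : 1 / d < m + 1 := Nat.lt_floor_add_one _
  have hm1 : 1 ≤ m := Nat.le_floor (by rw [Nat.cast_one, le_div_iff₀ hd0]; linarith)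
  have hmm₀ : m₀ ≤ m := by
    refine Nat.le_floor ?_
    rw [lt_div_iff₀ (by positivity)] at hs''
    rw [le_div_iff₀ hd0]
    nlinarith
  have hm0 : (0 : ℝ) < m := by exact_mod_cast hm1
  have hm1' : (1 : ℝ) ≤ m := by exact_mod_cast hm1
  have hdm : d ≤ 1 / m := by rw [le_div_iff₀ hm0, mul_comm]; exact (le_div_iff₀ hd0).1 hm_le
  obtain ⟨hc, hl⟩ := hm₀ m hmm₀
  have key : ∀ u v : I, u ≤ v → (v : ℝ) - u = d → (∀ x ∈ Ioc u v, |(x : ℝ) - t| ≤ d) →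
      f v - f u ≤ (m : ℝ) ^ (-α) := by
    intro u v huv hvu hx
    -- The window starts at the grid point just below `u`. Width `2 / m` suffices since `v - u = d ≤
    -- 1 / m`.
    have hk : ⌊(u : ℝ) * m⌋₊ ≤ m := by
      refine Nat.floor_le_of_le ?_
      nlinarith [u.2.2]
    refine le_of_tendsto (hf.hasSum_sub huv).tendsto_sum_nat
      (Eventually.of_forall fun N => ?_)
    refine le_trans (Finset.sum_le_sum fun n _ => ?_) ((hc _ hk N).trans hl)
    by_cases hn : τ n ∈ Ioc u v
    swap
    · rw [indicator_of_notMem hn]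
      exact indicator_nonneg (fun _ _ => by positivity) _
    have hτd := hx _ hn
    have hτr : τ n ∈ Metric.ball t r := lt_of_le_of_lt hτd hs
    have hnn₁ : n₁ ≤ n := by
      by_contra! hlt
      exact (hball hτr).2 n hlt rfl
    obtain ⟨h1, h2⟩ := hn₁ n hnn₁
    have hmem : (m : ℝ) ^ q ≤ n + 1 ∧
        (τ n : ℝ) ∈ Icc ((⌊(u : ℝ) * m⌋₊ : ℝ) / m) ((⌊(u : ℝ) * m⌋₊ + 2) / m) := by
      refine ⟨?_, ?_, ?_⟩
      · have h3 : ((n : ℝ) + 1) ^ (-q⁻¹) ≤ 1 / m := h1.trans (hτd.trans hdm)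
        rw [Real.rpow_neg (by positivity), ← one_div, one_div_le_one_div (by positivity) hm0] at h3
        calc (m : ℝ) ^ q ≤ (((n : ℝ) + 1) ^ q⁻¹) ^ q := Real.rpow_le_rpow hm0.le h3 hq.le
          _ = n + 1 := Real.rpow_inv_rpow (by positivity) hq.ne'
      · rw [div_le_iff₀ hm0]
        have h4 : (u : ℝ) < τ n := hn.1
        calc (⌊(u : ℝ) * m⌋₊ : ℝ) ≤ u * m := Nat.floor_le (mul_nonneg u.2.1 hm0.le)
          _ ≤ τ n * m := by gcongr
      · rw [le_div_iff₀ hm0]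
        have h4 : (τ n : ℝ) ≤ v := hn.2
        have h5 : (u : ℝ) * m < ⌊(u : ℝ) * m⌋₊ + 1 := Nat.lt_floor_add_one _
        have h6 : d * m ≤ 1 := (le_div_iff₀ hm0).1 hdm
        nlinarith
    rw [indicator_of_mem hn]
    refine (h2 (hball hτr).1).trans (le_of_eq ?_)
    exact (indicator_of_mem (s := {n : ℕ | _}) (mem_ofPred_eq ▸ hmem)
      fun n : ℕ => ((n : ℝ) + 1) ^ (-(β + η))).symm
  have hmain : |f s - f t| ≤ (m : ℝ) ^ (-α) := by
    have hmono := hf.monotone hJ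
    rcases le_total s t with hle | hle
    · have hle' : (s : ℝ) ≤ t := hle
      rw [abs_sub_comm, abs_of_nonneg (sub_nonneg.2 (hmono hle))]
      refine key s t hle (by rw [hd, abs_sub_comm, abs_of_nonneg (sub_nonneg.2 hle')]) ?_
      intro x hx
      have h1 : (s : ℝ) < x := hx.1
      have h2 : (x : ℝ) ≤ t := hx.2
      rw [hd, abs_sub_comm, abs_of_nonneg (sub_nonneg.2 h2), abs_sub_comm,
        abs_of_nonneg (sub_nonneg.2 hle')]
      linarith
    · have hle' : (t : ℝ) ≤ s := hle
      rw [abs_of_nonneg (sub_nonneg.2 (hmono hle))]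
      refine key t s hle (by rw [hd, abs_of_nonneg (sub_nonneg.2 hle')]) ?_
      intro x hx
      have h1 : (t : ℝ) < x := hx.1
      have h2 : (x : ℝ) ≤ s := hx.2
      rw [hd, abs_of_nonneg (sub_nonneg.2 h1.le), abs_of_nonneg (sub_nonneg.2 hle')]
      linarith
  refine hmain.trans ?_
  -- Here `1 / d < m + 1 ≤ 2 * m`, so `1 / m ≤ 2 * d`; this is the constant `2 ^ α`.
  rw [← Real.mul_rpow (by norm_num) hd0.le, Real.rpow_neg hm0.le, ← Real.inv_rpow hm0.le]
  refine Real.rpow_le_rpow (by positivity) ?_ hα.le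
  rw [inv_le_comm₀ hm0 (by positivity)]
  rw [div_lt_iff₀ hd0] at hm_lt
  rw [inv_le_iff_one_le_mul₀ (by positivity)]
  nlinarith

/-! ### Arrival heights -/

lemma integrable_id_expMeasure_one : Integrable (fun x : ℝ => x) (expMeasure 1) ∧
    ∫ x, x ∂(expMeasure 1) = 1 := by
  have hint : IntegrableOn (fun x : ℝ => Real.exp (-x) * x) (Ioi 0) := by
    simpa [show (2 : ℝ) - 1 = 1 by norm_num] using Real.GammaIntegral_convergent (s := 2) two_pos
  have hval : ∫ x in Ioi (0 : ℝ), Real.exp (-x) * x = 1 := by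
    have h := Real.Gamma_eq_integral (s := 2) two_pos
    rw [Real.Gamma_two] at h
    simpa [show (2 : ℝ) - 1 = 1 by norm_num] using h.symm
  have hpdf : (fun x : ℝ => (exponentialPDF 1 x).toReal • x) =
      (Ici (0 : ℝ)).indicator fun x => Real.exp (-x) * x := by
    ext x
    by_cases hx : 0 ≤ x
    · rw [indicator_of_mem (mem_Ici.2 hx), exponentialPDF_of_nonneg hx, ENNReal.toReal_ofReal (by positivity)]
      simp
    · rw [indicator_of_notMem (mt mem_Ici.1 hx), exponentialPDF_of_neg (not_le.1 hx)]
      simp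
  have hmeas : Measurable (exponentialPDF 1) :=
    (measurable_exponentialPDFReal 1).ennreal_ofReal
  have hfin : ∀ᵐ x : ℝ, exponentialPDF 1 x < ∞ := by simp [exponentialPDF]
  have hdef : expMeasure 1 = volume.withDensity (exponentialPDF 1) := rfl
  rw [hdef]
  constructor
  · rw [integrable_withDensity_iff_integrable_smul' hmeas hfin, hpdf,
      integrable_indicator_iff measurableSet_Ici, integrableOn_Ici_iff_integrableOn_Ioi]
    exact hint
  · rw [integral_withDensity_eq_integral_toReal_smul hmeas hfin, hpdf,
      integral_indicator measurableSet_Ici, integral_Ici_eq_integral_Ioi, hval]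

lemma ae_nonneg_expMeasure_one : ∀ᵐ x ∂(expMeasure 1), 0 ≤ x := by
  have hdef : expMeasure 1 = volume.withDensity (exponentialPDF 1) := rfl
  have hmeas : Measurable (exponentialPDF 1) :=
    (measurable_exponentialPDFReal 1).ennreal_ofReal
  rw [hdef, ae_withDensity_iff hmeas]
  refine Eventually.of_forall fun x hx => ?_
  by_contra! h
  exact hx (exponentialPDF_of_neg h)

section Input

variable {Ω : Type*} [MeasurableSpace Ω] {P : Measure Ω}
  {T : ℕ → Ω → I} {Y : ℕ → Ω → ℝ}

lemma IsPoissonInput.ae_poissonHeight_nonneg (h : IsPoissonInput P T Y) :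
    ∀ᵐ ω ∂P, ∀ n, 0 ≤ poissonHeight Y n ω := by
  have hY : ∀ᵐ ω ∂P, ∀ n, 0 ≤ Y n ω := by
    refine ae_all_iff.2 fun n => ?_
    refine ae_of_ae_map (h.measurable_Y n).aemeasurable ?_
    rw [h.law_Y n]
    exact ae_nonneg_expMeasure_one
  filter_upwards [hY] with ω hω n using Finset.sum_nonneg fun i _ => hω i

lemma IsPoissonInput.ae_tendsto_poissonHeight_div (h : IsPoissonInput P T Y) :
    ∀ᵐ ω ∂P, Tendsto (fun n : ℕ => poissonHeight Y n ω / ((n : ℝ) + 1)) atTop (𝓝 1) := by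
  have hmean : P[Y 0] = 1 := by
    rw [← integrable_id_expMeasure_one.2, ← h.law_Y 0,
      integral_map (h.measurable_Y 0).aemeasurable (by fun_prop)]
  have hint : Integrable (Y 0) P := by
    have h1 := integrable_id_expMeasure_one.1
    rw [← h.law_Y 0] at h1
    exact h1.comp_measurable (h.measurable_Y 0)
  have hslln := strong_law_ae_real Y hint (fun i j hij => h.indep_Y.indepFun hij)
    fun i => ⟨(h.measurable_Y i).aemeasurable, (h.measurable_Y 0).aemeasurable,
      by rw [h.law_Y, h.law_Y]⟩
  filter_upwards [hslln] with ω hω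
  rw [hmean] at hω
  simpa [poissonHeight, Function.comp_def] using hω.comp (tendsto_add_atTop_nat 1)

lemma IsPoissonInput.ae_ne (h : IsPoissonInput P T Y) (x : I) : ∀ᵐ ω ∂P, ∀ n, T n ω ≠ x := by
  refine ae_all_iff.2 fun n => ?_
  refine ae_of_ae_map (p := fun y => y ≠ x) (h.measurable_T n).aemeasurable ?_
  rw [h.law_T n]
  simp [ae_iff]

/-! ### Covering by the balls around the arrival times -/

lemma IsPoissonInput.measure_forall_notMem (h : IsPoissonInput P T Y) (s : Finset ℕ)
    {A : ℕ → Set I} (hA : ∀ n, MeasurableSet (A n)) :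
    P {ω | ∀ n ∈ s, T n ω ∉ A n} = ∏ n ∈ s, (1 - volume (A n)) := by
  have h1 := h.indep_T.measure_inter_preimage_eq_mul s (sets := fun n => (A n)ᶜ)
    fun n _ => (hA n).compl
  have h2 : {ω | ∀ n ∈ s, T n ω ∉ A n} = ⋂ n ∈ s, T n ⁻¹' (A n)ᶜ := by
    ext ω; simp
  rw [h2, h1]
  refine Finset.prod_congr rfl fun n _ => ?_
  rw [← Measure.map_apply (h.measurable_T n) (hA n).compl, h.law_T n, prob_compl_eq_one_sub (hA n)]

lemma log_div_le_sum_one_div {a b : ℕ} (hab : a ≤ b) :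
    Real.log ((b + 1) / (a + 1)) ≤ ∑ n ∈ Finset.Ico a b, 1 / ((n : ℝ) + 1) := by
  induction b, hab using Nat.le_induction with
  | base => simp [div_self (by positivity : (a : ℝ) + 1 ≠ 0)]
  | succ b hab ih =>
    rw [Finset.sum_Ico_succ_top hab]
    have h1 : ((b + 1 : ℕ) + 1 : ℝ) / (a + 1) = (b + 1) / (a + 1) * (1 + 1 / (b + 1)) := by
      push_cast
      field_simp
    rw [h1, Real.log_mul (by positivity) (by positivity)]
    have h2 := Real.log_le_sub_one_of_pos (by positivity : (0 : ℝ) < 1 + 1 / (b + 1))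
    linarith

/-- The probability that no point `T n`, `a ≤ n < b`, falls into a ball around `x` of radius
`3 / (4 (n + 1)) - e`, when small balls around `x` have at least `κ` times the mass of their
radius. -/
lemma IsPoissonInput.measure_forall_le_dist (h : IsPoissonInput P T Y) {a b : ℕ} (hab : a ≤ b)
    {x : I} {κ e : ℝ} (hκ : 0 ≤ κ) (he : 0 ≤ e)
    (hx : ∀ n, a ≤ n → ∀ ρ ≤ 3 / 4 / ((n : ℝ) + 1),
      ENNReal.ofReal (κ * ρ) ≤ volume (Metric.ball x ρ)) :
    P {ω | ∀ n ∈ Finset.Ico a b, 3 / 4 / ((n : ℝ) + 1) - e ≤ dist (T n ω) x} ≤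
      ENNReal.ofReal (Real.exp (κ * e * b) * (((b : ℝ) + 1) / (a + 1)) ^ (-(3 / 4 * κ))) := by
  set ρ : ℕ → ℝ := fun n => 3 / 4 / ((n : ℝ) + 1) - e with hρ
  have hsub : {ω | ∀ n ∈ Finset.Ico a b, ρ n ≤ dist (T n ω) x} ⊆
      {ω | ∀ n ∈ Finset.Ico a b, T n ω ∉ Metric.ball x (ρ n)} :=
    fun ω hω n hn => not_lt.2 (hω n hn)
  refine (measure_mono hsub).trans ?_
  rw [h.measure_forall_notMem _ fun n => Metric.isOpen_ball.measurableSet]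
  -- The radius `ρ n` may be negative; then `ENNReal.ofReal` vanishes and the exponential is at
  -- least `1`, so the bound persists.
  have hfac : ∀ n ∈ Finset.Ico a b,
      1 - volume (Metric.ball x (ρ n)) ≤ ENNReal.ofReal (Real.exp (-(κ * ρ n))) := by
    intro n hn
    have h1 := hx n (Finset.mem_Ico.1 hn).1 (ρ n) (by simp only [hρ]; linarith)
    refine (tsub_le_tsub_left h1 1).trans ?_
    rw [tsub_le_iff_right]
    calc (1 : ℝ≥0∞) = ENNReal.ofReal (-(κ * ρ n) + 1 + κ * ρ n) := by simp
      _ ≤ ENNReal.ofReal (-(κ * ρ n) + 1) + ENNReal.ofReal (κ * ρ n) := ENNReal.ofReal_add_le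
      _ ≤ _ := by gcongr; exact Real.add_one_le_exp _
  refine (Finset.prod_le_prod' hfac).trans ?_
  rw [← ENNReal.ofReal_prod_of_nonneg fun n _ => (Real.exp_pos _).le, ← Real.exp_sum]
  refine ENNReal.ofReal_le_ofReal ?_
  have hpos : (0 : ℝ) < (b + 1) / (a + 1) := by positivity
  rw [Real.rpow_def_of_pos hpos, ← Real.exp_add]
  refine Real.exp_le_exp.2 ?_
  have hsum : ∑ n ∈ Finset.Ico a b, -(κ * ρ n) =
      κ * e * (b - a) - 3 / 4 * κ * ∑ n ∈ Finset.Ico a b, 1 / ((n : ℝ) + 1) := by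
    have h2 : ∀ n ∈ Finset.Ico a b,
        -(κ * ρ n) = κ * e - 3 / 4 * κ * (1 / ((n : ℝ) + 1)) := by
      intro n _
      simp only [hρ]
      ring
    rw [Finset.sum_congr rfl h2, Finset.sum_sub_distrib, Finset.sum_const, Nat.card_Ico,
      Finset.mul_sum, nsmul_eq_mul, Nat.cast_sub hab]
    ring
  rw [hsum]
  have h3 := mul_le_mul_of_nonneg_left (log_div_le_sum_one_div hab)
    (by positivity : 0 ≤ 3 / 4 * κ)
  have h4 : 0 ≤ κ * e * a := by positivity
  linarith

lemma ofReal_sub_le_volume_ball {x : I} {ρ lo hi : ℝ} (hlo : 0 ≤ lo) (hhi : hi ≤ 1)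
    (hl : (x : ℝ) - ρ ≤ lo) (hr : hi ≤ x + ρ) :
    ENNReal.ofReal (hi - lo) ≤ volume (Metric.ball x ρ) := by
  rw [unitInterval.volume_apply, ← Real.volume_Ioo]
  refine measure_mono fun y hy => ⟨⟨y, by linarith [hy.1], by linarith [hy.2]⟩, ?_, rfl⟩
  rw [Metric.mem_ball, Subtype.dist_eq, Real.dist_eq, abs_lt]
  constructor
  · linarith [hy.1]
  · linarith [hy.2]

lemma tendsto_ofReal_const_mul_rpow_neg (C : ℝ) {p : ℝ} (hp : 0 < p) :
    Tendsto (fun b : ℕ => ENNReal.ofReal (C * ((b : ℝ) + 1) ^ (-p))) atTop (𝓝 0) := by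
  have h := ((tendsto_rpow_neg_atTop hp).comp tendsto_natCast_add_one_atTop).const_mul C
  rw [mul_zero] at h
  simpa using ENNReal.tendsto_ofReal h

/-- Balls around an endpoint are one-sided (`κ = 1`), so the chance of a miss decays only like `b ^
(-3/4)`. That would not survive a union over a grid, but suffices for a single point. -/
lemma IsPoissonInput.ae_exists_dist_lt_of_endpoint (h : IsPoissonInput P T Y) {x : I}
    (hx : x = 0 ∨ x = 1) (a : ℕ) :
    ∀ᵐ ω ∂P, ∃ n ≥ a, dist (T n ω) x < 3 / 4 / ((n : ℝ) + 1) := by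
  have hball : ∀ n, a ≤ n → ∀ ρ ≤ 3 / 4 / ((n : ℝ) + 1),
      ENNReal.ofReal (1 * ρ) ≤ volume (Metric.ball x ρ) := by
    intro n _ ρ hρ
    have hρ1 : ρ ≤ 1 := by
      refine hρ.trans ?_
      rw [div_le_one (by positivity)]
      linarith [n.cast_nonneg (α := ℝ)]
    rcases le_total ρ 0 with hρ0 | hρ0
    · simp [ENNReal.ofReal_of_nonpos hρ0]
    rcases hx with rfl | rfl
    · simpa using ofReal_sub_le_volume_ball (x := 0) (ρ := ρ) (lo := 0) (hi := ρ) le_rfl hρ1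
        (by simpa using hρ0) (by simp)
    · simpa using ofReal_sub_le_volume_ball (x := 1) (ρ := ρ) (lo := 1 - ρ) (hi := 1)
        (by linarith) le_rfl (by simp) (by simpa using hρ0)
  rw [ae_iff]
  refine le_antisymm (ge_of_tendsto (tendsto_ofReal_const_mul_rpow_neg
    (((a : ℝ) + 1) ^ (3 / 4 : ℝ)) (by norm_num : (0 : ℝ) < 3 / 4)) ?_) zero_le
  filter_upwards [eventually_ge_atTop a] with b hab
  refine le_trans (measure_mono (t := {ω | ∀ n ∈ Finset.Ico a b,
    3 / 4 / ((n : ℝ) + 1) - 0 ≤ dist (T n ω) x}) fun ω hω n hn => ?_)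
    ((h.measure_forall_le_dist hab zero_le_one (le_refl (0 : ℝ)) hball).trans
      (ENNReal.ofReal_le_ofReal (le_of_eq ?_)))
  · simp only [not_exists, not_and, not_lt, mem_ofPred_eq] at hω
    simpa using hω n (Finset.mem_Ico.1 hn).1
  · rw [Real.div_rpow (by positivity) (by positivity), mul_one,
      Real.rpow_neg (by positivity : (0 : ℝ) ≤ a + 1)]
    simp
    ring

/-- Two-sided balls (`κ = 2`) make the chance of a miss at one point of order `b ^ (-3/2)`, which
beats the `b + 1` points of a grid of mesh `1 / b`. Passing from `t` to the grid costs `e = 1 / b`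
in each radius, hence only a factor `exp 2`. The margin `2 * r` keeps grid points at distance `r`
from the endpoints. -/
lemma IsPoissonInput.ae_exists_dist_lt_of_interior (h : IsPoissonInput P T Y) {r : ℝ}
    (hr : 0 < r) {a : ℕ} (ha : 1 ≤ r * ((a : ℝ) + 1)) :
    ∀ᵐ ω ∂P, ∀ t : I, 2 * r ≤ t → (t : ℝ) ≤ 1 - 2 * r →
      ∃ n ≥ a, dist (T n ω) t < 3 / 4 / ((n : ℝ) + 1) := by
  have hball : ∀ x : I, r ≤ x → (x : ℝ) ≤ 1 - r → ∀ n, a ≤ n → ∀ ρ ≤ 3 / 4 / ((n : ℝ) + 1),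
      ENNReal.ofReal (2 * ρ) ≤ volume (Metric.ball x ρ) := by
    intro x hx hx' n hn ρ hρ
    have hn' : (a : ℝ) ≤ n := by exact_mod_cast hn
    have hρr : ρ ≤ r := by
      refine hρ.trans ?_
      rw [div_le_iff₀ (by positivity)]
      nlinarith
    have := ofReal_sub_le_volume_ball (x := x) (ρ := ρ) (lo := x - ρ) (hi := x + ρ)
      (by linarith) (by linarith) le_rfl le_rfl
    rwa [show (x : ℝ) + ρ - (x - ρ) = 2 * ρ by ring] at this
  rw [ae_iff]
  refine le_antisymm (ge_of_tendsto (tendsto_ofReal_const_mul_rpow_neg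
    (Real.exp 2 * ((a : ℝ) + 1) ^ (3 / 2 : ℝ)) (by norm_num : (0 : ℝ) < 1 / 2)) ?_) zero_le
  filter_upwards [eventually_ge_atTop a, eventually_gt_atTop 0,
    tendsto_natCast_atTop_atTop.eventually_ge_atTop r⁻¹] with b hab hb0 hbr
  have hb : (0 : ℝ) < b := by exact_mod_cast hb0
  have hbr' : 1 / (b : ℝ) ≤ r := by rw [one_div]; exact inv_le_of_inv_le₀ hr hbr
  let x : ℕ → I := fun k => projIcc 0 1 zero_le_one ((k : ℝ) / b)
  let E : ℕ → Set Ω := fun k => {ω | (r ≤ x k ∧ (x k : ℝ) ≤ 1 - r) ∧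
    ∀ n ∈ Finset.Ico a b, 3 / 4 / ((n : ℝ) + 1) - 1 / b ≤ dist (T n ω) (x k)}
  have hE : ∀ k, P (E k) ≤
      ENNReal.ofReal (Real.exp 2 * (((b : ℝ) + 1) / (a + 1)) ^ (-(3 / 2 : ℝ))) := by
    intro k
    by_cases hk : r ≤ x k ∧ (x k : ℝ) ≤ 1 - r
    · refine (measure_mono fun ω hω => hω.2).trans ((h.measure_forall_le_dist hab zero_le_two
        (by positivity : 0 ≤ 1 / (b : ℝ)) (hball (x k) hk.1 hk.2)).trans (le_of_eq ?_))
      rw [show 2 * (1 / (b : ℝ)) * b = 2 by field_simp, show (3 / 4 * 2 : ℝ) = 3 / 2 by norm_num]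
    · have : E k = ∅ := eq_empty_of_forall_notMem fun ω hω => hk hω.1
      simp [this]
  have hsub : {ω | ¬ ∀ t : I, 2 * r ≤ t → (t : ℝ) ≤ 1 - 2 * r →
      ∃ n ≥ a, dist (T n ω) t < 3 / 4 / ((n : ℝ) + 1)} ⊆ ⋃ k ∈ Finset.range (b + 1), E k := by
    intro ω hω
    simp only [mem_ofPred_eq, not_forall, not_exists, not_and, not_lt] at hω
    obtain ⟨t, ht1, ht2, ht⟩ := hω
    have hfl : (⌊(t : ℝ) * b⌋₊ : ℝ) ≤ t * b := Nat.floor_le (mul_nonneg t.2.1 hb.le)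
    have hfl' : (t : ℝ) * b < ⌊(t : ℝ) * b⌋₊ + 1 := Nat.lt_floor_add_one _
    have hk1 : (⌊(t : ℝ) * b⌋₊ : ℝ) / b ≤ t := (div_le_iff₀ hb).2 hfl
    have hk2 : (t : ℝ) - 1 / b ≤ (⌊(t : ℝ) * b⌋₊ : ℝ) / b := by
      rw [le_div_iff₀ hb, sub_mul, one_div_mul_cancel hb.ne']
      linarith
    have hxk : (x ⌊(t : ℝ) * b⌋₊ : ℝ) = (⌊(t : ℝ) * b⌋₊ : ℝ) / b := by
      rw [show x ⌊(t : ℝ) * b⌋₊ = projIcc 0 1 zero_le_one ((⌊(t : ℝ) * b⌋₊ : ℝ) / b) from rfl,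
        projIcc_of_mem zero_le_one ⟨by positivity, hk1.trans t.2.2⟩]
    have hkb : ⌊(t : ℝ) * b⌋₊ ≤ b := Nat.floor_le_of_le (by nlinarith [t.2.2])
    refine mem_biUnion (Finset.mem_coe.2 (Finset.mem_range.2 (Nat.lt_succ_of_le hkb)))
      ⟨⟨by rw [hxk]; linarith, by rw [hxk]; linarith⟩, fun n hn => ?_⟩
    have h1 := ht n (Finset.mem_Ico.1 hn).1
    have h2 := dist_triangle (T n ω) (x ⌊(t : ℝ) * b⌋₊) t
    have h3 : dist (x ⌊(t : ℝ) * b⌋₊) t ≤ 1 / b := by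
      rw [Subtype.dist_eq, Real.dist_eq, hxk, abs_le]
      constructor
      · linarith
      · have : 0 < 1 / (b : ℝ) := by positivity
        linarith
    linarith
  refine (measure_mono hsub).trans ((measure_biUnion_finset_le _ _).trans
    ((Finset.sum_le_sum fun k _ => hE k).trans ?_))
  rw [Finset.sum_const, Finset.card_range, nsmul_eq_mul, ← ENNReal.ofReal_natCast,
    ← ENNReal.ofReal_mul (by positivity)]
  refine ENNReal.ofReal_le_ofReal (le_of_eq ?_)
  rw [Real.div_rpow (by positivity) (by positivity),
    Real.rpow_neg (by positivity : (0 : ℝ) ≤ a + 1), div_inv_eq_mul]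
  have h1 : ((b : ℝ) + 1) ^ (-(1 / 2) : ℝ) = (b + 1) * ((b : ℝ) + 1) ^ (-(3 / 2) : ℝ) := by
    rw [← Real.rpow_one_add' (by positivity) (by norm_num)]
    norm_num
  rw [h1]
  push_cast
  ring

/-- Almost surely, every point of the unit interval lies in infinitely many of the balls
`B(Tₙ, 3 / (4 (n + 1)))`. -/
lemma IsPoissonInput.ae_forall_frequently_dist_lt (h : IsPoissonInput P T Y) :
    ∀ᵐ ω ∂P, ∀ t : I, ∃ᶠ n : ℕ in atTop, dist (T n ω) t < 3 / 4 / ((n : ℝ) + 1) := by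
  have h0 := ae_all_iff.2 (h.ae_exists_dist_lt_of_endpoint (Or.inl rfl : (0 : I) = 0 ∨ (0 : I) = 1))
  have h1 := ae_all_iff.2 (h.ae_exists_dist_lt_of_endpoint (Or.inr rfl : (1 : I) = 0 ∨ (1 : I) = 1))
  have hi : ∀ᵐ ω ∂P, ∀ c a : ℕ, c ≤ a → ∀ t : I, 2 * (1 / ((c : ℝ) + 1)) ≤ t →
      (t : ℝ) ≤ 1 - 2 * (1 / ((c : ℝ) + 1)) → ∃ n ≥ a, dist (T n ω) t < 3 / 4 / ((n : ℝ) + 1) := by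
    refine ae_all_iff.2 fun c => ae_all_iff.2 fun a => ?_
    by_cases hca : c ≤ a
    · have hca' : (c : ℝ) ≤ a := by exact_mod_cast hca
      filter_upwards [h.ae_exists_dist_lt_of_interior (r := 1 / ((c : ℝ) + 1)) (by positivity)
        (a := a) (by rw [one_div_mul_eq_div, le_div_iff₀ (by positivity)]; linarith)] with ω hω _
        using hω
    · exact Eventually.of_forall fun ω hc => absurd hc hca
  filter_upwards [h0, h1, hi] with ω h0 h1 hi t
  refine frequently_atTop.2 fun a => ?_
  rcases eq_or_ne t 0 with rfl | ht0
  · exact h0 a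
  rcases eq_or_ne t 1 with rfl | ht1
  · exact h1 a
  have hpos : 0 < (t : ℝ) := unitInterval.coe_pos.2 (unitInterval.pos_iff_ne_zero.2 ht0)
  have hlt : (t : ℝ) < 1 := unitInterval.coe_lt_one.2 (unitInterval.lt_one_iff_ne_one.2 ht1)
  -- The margin must be independent of `t` for each null set, so it runs through the values `1 / (c
  -- + 1)`.
  obtain ⟨c, hc⟩ := exists_nat_one_div_lt (half_pos (lt_min hpos (sub_pos.2 hlt)))
  have hc1 := min_le_left (t : ℝ) (1 - t)
  have hc2 := min_le_right (t : ℝ) (1 - t)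
  obtain ⟨n, hn, hd⟩ := hi c (max a c) (le_max_right _ _) t (by linarith) (by linarith)
  exact ⟨n, (le_max_left _ _).trans hn, hd⟩

end Input

/-! ### Uniform control of the late jumps -/

section Control

variable {Ω : Type*} [MeasurableSpace Ω] {P : Measure Ω} [IsProbabilityMeasure P]
  {T : ℕ → Ω → I} {Y : ℕ → Ω → ℝ}

lemma rpow_mul_rpow_neg_add_le {ρ x β η : ℝ} (hρ : 1 ≤ ρ) (hx : ρ ≤ x) (hβ : 1 < β) :
    ρ ^ β * x ^ (-(β + η)) ≤ ρ * x ^ (-(1 + η)) := by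
  have hρ0 : 0 < ρ := by linarith
  have hx0 : 0 < x := by linarith
  have h1 : ρ ^ β = ρ * ρ ^ (β - 1) := by
    rw [← Real.rpow_one_add' hρ0.le (by linarith)]; ring_nf
  have h2 : x ^ (-(β + η)) = x ^ (-(β - 1)) * x ^ (-(1 + η)) := by
    rw [← Real.rpow_add hx0]; ring_nf
  have h3 : ρ ^ (β - 1) * x ^ (-(β - 1)) ≤ 1 := by
    rw [Real.rpow_neg hx0.le, ← div_eq_mul_inv, div_le_one (by positivity)]
    exact Real.rpow_le_rpow hρ0.le hx (by linarith)
  calc ρ ^ β * x ^ (-(β + η))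
      = (ρ * x ^ (-(1 + η))) * (ρ ^ (β - 1) * x ^ (-(β - 1))) := by rw [h1, h2]; ring
    _ ≤ (ρ * x ^ (-(1 + η))) * 1 := by gcongr
    _ = _ := mul_one _

/-- Chernoff bound for a weighted number of points in a set. -/
lemma IsPoissonInput.measureReal_le_sum_indicator (h : IsPoissonInput P T Y) {A : Set I}
    (hA : MeasurableSet A) {v : ℕ → ℝ} {c C a : ℝ} (hc : 0 ≤ c) (hv : ∀ n, 0 ≤ v n)
    (hv1 : ∀ n, c * v n ≤ 1) (N : ℕ) (hC : ∑ n ∈ Finset.range N, c * v n ≤ C) :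
    P.real {ω | a ≤ ∑ n ∈ Finset.range N, A.indicator (fun _ => v n) (T n ω)} ≤
      Real.exp (-c * a) * Real.exp (2 * volume.real A * C) := by
  set X : ℕ → Ω → ℝ := fun n ω => A.indicator (fun _ => v n) (T n ω) with hX
  have hXm : ∀ n, Measurable (X n) := fun n =>
    (measurable_const.indicator hA).comp (h.measurable_T n)
  have hXi : iIndepFun X P :=
    h.indep_T.comp (fun n => A.indicator fun _ => v n) fun n => measurable_const.indicator hA
  -- Uses `exp x ≤ 1 + 2 * x` for `0 ≤ x ≤ 1`.
  have hbound : ∀ n ω, Real.exp (c * X n ω) ≤ 1 + A.indicator (fun _ => 2 * (c * v n)) (T n ω) := by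
    intro n ω
    by_cases hω : T n ω ∈ A
    · simp only [hX, indicator_of_mem hω]
      have h0 : 0 ≤ c * v n := mul_nonneg hc (hv n)
      have := (abs_le.1 (Real.abs_exp_sub_one_le (x := c * v n)
        (by rw [abs_of_nonneg h0]; exact hv1 n))).2
      rw [abs_of_nonneg h0] at this
      linarith
    · simp [hX, indicator_of_notMem hω]
  have hind : ∀ n, Integrable (fun ω => 1 + A.indicator (fun _ => 2 * (c * v n)) (T n ω)) P := by
    intro n
    refine (integrable_const _).add ?_
    have : (fun ω => A.indicator (fun _ => 2 * (c * v n)) (T n ω)) =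
        (T n ⁻¹' A).indicator fun _ => 2 * (c * v n) := rfl
    rw [this]
    exact (integrable_const _).indicator (h.measurable_T n hA)
  have hint : ∀ n, Integrable (fun ω => Real.exp (c * X n ω)) P := fun n =>
    (hind n).mono' (((hXm n).const_mul c).exp.aestronglyMeasurable)
      (Eventually.of_forall fun ω => by
        rw [Real.norm_of_nonneg (Real.exp_pos _).le]; exact hbound n ω)
  have hmgf : ∀ n, mgf (X n) P c ≤ Real.exp (2 * volume.real A * (c * v n)) := by
    intro n
    calc mgf (X n) P c ≤ ∫ ω, 1 + A.indicator (fun _ => 2 * (c * v n)) (T n ω) ∂P :=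
          integral_mono (hint n) (hind n) (hbound n)
      _ = 1 + volume.real A * (2 * (c * v n)) := by
          have h1 : (fun ω => A.indicator (fun _ => 2 * (c * v n)) (T n ω)) =
            (T n ⁻¹' A).indicator fun _ => 2 * (c * v n) := rfl
          rw [integral_add (integrable_const _) (h1 ▸ (integrable_const _).indicator
            (h.measurable_T n hA)), h1, integral_indicator_const _ (h.measurable_T n hA),
            ← map_measureReal_apply (h.measurable_T n) hA, h.law_T n]
          simp
      _ ≤ Real.exp (2 * volume.real A * (c * v n)) := by
          have := Real.add_one_le_exp (2 * volume.real A * (c * v n))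
          linarith
  have hsum : (fun ω => ∑ n ∈ Finset.range N, X n ω) = ∑ n ∈ Finset.range N, X n := by
    ext ω; simp
  have hch := measure_ge_le_exp_mul_mgf (μ := P) (X := ∑ n ∈ Finset.range N, X n) (t := c) a hc
    (hXi.integrable_exp_mul_sum hXm fun n _ => hint n)
  rw [hXi.mgf_sum hXm] at hch
  rw [← hsum] at hch
  refine hch.trans ?_
  gcongr
  calc ∏ n ∈ Finset.range N, mgf (X n) P c
      ≤ ∏ n ∈ Finset.range N, Real.exp (2 * volume.real A * (c * v n)) :=
        Finset.prod_le_prod (fun n _ => mgf_nonneg) fun n _ => hmgf n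
    _ = Real.exp (2 * volume.real A * ∑ n ∈ Finset.range N, c * v n) := by
        rw [← Real.exp_sum, Finset.mul_sum]
    _ ≤ _ := by gcongr

lemma volume_real_preimage_Icc_le {x y : ℝ} (hxy : x ≤ y) :
    (volume : Measure I).real {s : I | (s : ℝ) ∈ Icc x y} ≤ y - x := by
  have h : volume {s : I | (s : ℝ) ∈ Icc x y} ≤ ENNReal.ofReal (y - x) := by
    rw [unitInterval.volume_apply, ← Real.volume_Icc]
    refine measure_mono ?_
    rintro _ ⟨s, hs, rfl⟩
    exact hs
  exact ENNReal.toReal_le_of_le_ofReal (sub_nonneg.2 hxy) h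

lemma summable_add_one_rpow_neg {p : ℝ} (hp : 1 < p) :
    Summable fun n : ℕ => ((n : ℝ) + 1) ^ (-p) := by
  have h := (summable_nat_add_iff 1).2 (Real.summable_nat_rpow.2 (neg_lt_neg hp))
  simpa using h

/-- Chernoff with parameter `c = m ^ (q * β)`: on `n + 1 ≥ m ^ q` the weights `c * v n` are at most
`1` and sum to at most `m * D`, where `η` provides summability. A window has measure at most `2 /
m`, so the exponential moment stays below `exp (4 * D)`, and the threshold is chosen so that `exp
(-c * a) = m ^ (-3)`. The `m + 1` windows leave order `m ^ (-2)`, ready for Borel–Cantelli. -/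
lemma IsPoissonInput.ae_hasUniformJumpControl (h : IsPoissonInput P T Y) {q β η : ℝ}
    (hq : 0 < q) (hq1 : q ≤ 1) (hβ : 1 < β) (hη : 0 < η) :
    ∀ᵐ ω ∂P, HasUniformJumpControl (fun n => T n ω) q β η := by
  have hsumm := summable_add_one_rpow_neg (by linarith : 1 < 1 + η)
  set D : ℝ := ∑' n : ℕ, ((n : ℝ) + 1) ^ (-(1 + η)) with hD
  have hD0 : 0 ≤ D := tsum_nonneg fun n => by positivity
  let A : ℕ → ℕ → Set I := fun m k => {s : I | (s : ℝ) ∈ Icc ((k : ℝ) / m) ((k + 2) / m)}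
  have hA : ∀ m k, MeasurableSet (A m k) := fun m k => measurable_subtype_coe measurableSet_Icc
  let v : ℕ → ℕ → ℝ := fun m =>
    {n : ℕ | (m : ℝ) ^ q ≤ n + 1}.indicator fun n => ((n : ℝ) + 1) ^ (-(β + η))
  have hv : ∀ m n, 0 ≤ v m n := fun m n => indicator_nonneg (fun _ _ => by positivity) _
  let S : ℕ → ℕ → ℕ → Ω → ℝ := fun m k N ω =>
    ∑ n ∈ Finset.range N, (A m k).indicator (fun _ => v m n) (T n ω)
  have hSmono : ∀ m k ω, Monotone fun N => S m k N ω := fun m k ω N N' hN =>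
    Finset.sum_le_sum_of_subset_of_nonneg (Finset.range_mono hN)
      fun n _ _ => indicator_nonneg (fun _ _ => hv m n) _
  let a : ℕ → ℝ := fun m => 3 * Real.log m * (m : ℝ) ^ (-(β * q))
  have hN : ∀ m k N, 0 < m → P {ω | a m ≤ S m k N ω} ≤
      ENNReal.ofReal ((m : ℝ) ^ (-3 : ℝ) * Real.exp (4 * D)) := by
    intro m k N hm
    have hm0 : (0 : ℝ) < m := by exact_mod_cast hm
    have hm1 : (1 : ℝ) ≤ m := by exact_mod_cast hm
    have hρ : 1 ≤ (m : ℝ) ^ q := Real.one_le_rpow hm1 hq.le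
    have hcv : ∀ n, ((m : ℝ) ^ q) ^ β * v m n ≤ (m : ℝ) ^ q * ((n : ℝ) + 1) ^ (-(1 + η)) := by
      intro n
      by_cases hn : (m : ℝ) ^ q ≤ n + 1
      · simp only [v, indicator, mem_ofPred_eq, hn, if_true]
        exact rpow_mul_rpow_neg_add_le hρ hn hβ
      · simp only [v, indicator, mem_ofPred_eq, hn, if_false, mul_zero]
        positivity
    have hcv1 : ∀ n, ((m : ℝ) ^ q) ^ β * v m n ≤ 1 := by
      intro n
      by_cases hn : (m : ℝ) ^ q ≤ n + 1
      · refine (hcv n).trans ?_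
        have hn1 : (1 : ℝ) ≤ n + 1 := hρ.trans hn
        calc (m : ℝ) ^ q * ((n : ℝ) + 1) ^ (-(1 + η))
            ≤ (n + 1) * ((n : ℝ) + 1) ^ (-(1 + η)) := by gcongr
          _ = ((n : ℝ) + 1) ^ (-η) := by
            rw [← Real.rpow_one_add' (by positivity) (by linarith)]; ring_nf
          _ ≤ 1 := Real.rpow_le_one_of_one_le_of_nonpos hn1 (by linarith)
      · simp [v, hn]
    have hsumle : ∑ n ∈ Finset.range N, ((m : ℝ) ^ q) ^ β * v m n ≤ m * D := by
      calc ∑ n ∈ Finset.range N, ((m : ℝ) ^ q) ^ β * v m n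
          ≤ ∑ n ∈ Finset.range N, (m : ℝ) ^ q * ((n : ℝ) + 1) ^ (-(1 + η)) :=
            Finset.sum_le_sum fun n _ => hcv n
        _ = (m : ℝ) ^ q * ∑ n ∈ Finset.range N, ((n : ℝ) + 1) ^ (-(1 + η)) := by
            rw [Finset.mul_sum]
        _ ≤ (m : ℝ) ^ (1 : ℝ) * D := by
            gcongr
            · exact hsumm.sum_le_tsum _ fun n _ => by positivity
        _ = m * D := by rw [Real.rpow_one]
    have hch := h.measureReal_le_sum_indicator (a := a m) (hA m k)
      (by positivity : 0 ≤ ((m : ℝ) ^ q) ^ β) (hv m) hcv1 N hsumle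
    rw [ENNReal.le_ofReal_iff_toReal_le (measure_ne_top _ _) (by positivity)]
    refine hch.trans ?_
    gcongr ?_ * Real.exp ?_
    · rw [Real.rpow_def_of_pos hm0 (-3)]
      refine Real.exp_le_exp.2 (le_of_eq ?_)
      have : ((m : ℝ) ^ q) ^ β * (m : ℝ) ^ (-(β * q)) = 1 := by
        rw [← Real.rpow_mul hm0.le, ← Real.rpow_add hm0]
        simp [mul_comm]
      calc -((m : ℝ) ^ q) ^ β * a m
          = -3 * Real.log m * (((m : ℝ) ^ q) ^ β * (m : ℝ) ^ (-(β * q))) := by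
            simp only [a]; ring
        _ = Real.log m * -3 := by rw [this]; ring
    · have hvol : volume.real (A m k) ≤ 2 / m := by
        refine (volume_real_preimage_Icc_le (by gcongr; linarith)).trans (le_of_eq ?_)
        ring
      calc 2 * volume.real (A m k) * (m * D) ≤ 2 * (2 / m) * (m * D) := by gcongr
        _ = 4 * D := by field_simp; ring
  have hU : ∀ m k, 0 < m → P (⋃ N, {ω | a m ≤ S m k N ω}) ≤
      ENNReal.ofReal ((m : ℝ) ^ (-3 : ℝ) * Real.exp (4 * D)) := by
    intro m k hm
    -- The terms are nonnegative, so the bad events increase with `N` and the bound passes to all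
    -- partial sums.
    have hmono : Monotone fun N => {ω | a m ≤ S m k N ω} :=
      fun N N' hNN' ω hω => le_trans hω (hSmono m k ω hNN')
    rw [hmono.measure_iUnion]
    exact iSup_le fun N => hN m k N hm
  let B : ℕ → Set Ω := fun m => {ω | 0 < m ∧ ∃ k ≤ m, ∃ N, a m ≤ S m k N ω}
  have hB : ∀ m, P (B m) ≤ ENNReal.ofReal ((m : ℝ) ^ (-2 : ℝ) * (2 * Real.exp (4 * D))) := by
    intro m
    rcases Nat.eq_zero_or_pos m with rfl | hm
    · have : B 0 = ∅ := eq_empty_of_forall_notMem fun ω hω => lt_irrefl _ hω.1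
      simp [this]
    have hm0 : (0 : ℝ) < m := by exact_mod_cast hm
    have hm1 : (1 : ℝ) ≤ m := by exact_mod_cast hm
    have hsub : B m ⊆ ⋃ k ∈ Finset.range (m + 1), ⋃ N, {ω | a m ≤ S m k N ω} := by
      rintro ω ⟨-, k, hk, N, hω⟩
      exact mem_biUnion (Finset.mem_coe.2 (Finset.mem_range.2 (Nat.lt_succ_of_le hk)))
        (mem_iUnion.2 ⟨N, hω⟩)
    refine (measure_mono hsub).trans ((measure_biUnion_finset_le _ _).trans
      ((Finset.sum_le_sum fun k _ => hU m k hm).trans ?_))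
    rw [Finset.sum_const, Finset.card_range, nsmul_eq_mul, ← ENNReal.ofReal_natCast,
      ← ENNReal.ofReal_mul (by positivity)]
    refine ENNReal.ofReal_le_ofReal ?_
    have h2 : (m : ℝ) ^ (-2 : ℝ) = m * (m : ℝ) ^ (-3 : ℝ) := by
      rw [← Real.rpow_one_add' (by positivity) (by norm_num)]
      norm_num
    rw [h2]
    push_cast
    calc ((m : ℝ) + 1) * ((m : ℝ) ^ (-3 : ℝ) * Real.exp (4 * D))
        ≤ (2 * m) * ((m : ℝ) ^ (-3 : ℝ) * Real.exp (4 * D)) := by gcongr; linarith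
      _ = _ := by ring
  have hfin : ∑' m, P (B m) ≠ ∞ := by
    refine ne_top_of_le_ne_top ?_ (ENNReal.tsum_le_tsum hB)
    have hs : Summable fun m : ℕ => (m : ℝ) ^ (-2 : ℝ) * (2 * Real.exp (4 * D)) :=
      (Real.summable_nat_rpow.2 (by norm_num)).mul_right _
    exact hs.tsum_ofReal_ne_top
  filter_upwards [ae_eventually_notMem hfin] with ω hω
  filter_upwards [hω, eventually_gt_atTop 0] with m hm hm0 k hk N
  have hlt : S m k N ω < a m := by
    by_contra! hle
    exact hm ⟨hm0, k, hk, N, hle⟩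
  refine le_trans (le_of_eq (Finset.sum_congr rfl fun n _ => ?_)) hlt.le
  by_cases h1 : (m : ℝ) ^ q ≤ n + 1 <;>
    by_cases h2 : (T n ω : ℝ) ∈ Icc ((k : ℝ) / m) ((k + 2) / m) <;>
    simp only [A, v, indicator, mem_ofPred_eq, h1, h2, and_self, and_true, and_false, if_true,
      if_false]

end Control

/-! ### Solutions as jump series -/

lemma leftLim_nonneg {f : I → ℝ} (hf : ∀ t, 0 ≤ f t) (t : I) : 0 ≤ Function.leftLim f t := by
  rcases eq_or_neBot (𝓝[<] t) with hbot | hne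
  · rw [leftLim_eq_of_eq_bot f hbot]
    exact hf t
  by_cases h : ∃ y, Tendsto f (𝓝[<] t) (𝓝 y)
  · obtain ⟨y, hy⟩ := h
    rw [leftLim_eq_of_tendsto hy]
    exact ge_of_tendsto hy (Eventually.of_forall hf)
  · rw [leftLim_eq_of_not_tendsto f h]
    exact hf t

lemma jumpSize_pos {β z : ℝ} (hz : 0 ≤ z) : 0 < jumpSize β z :=
  Real.rpow_pos_of_pos (by linarith) _

/-- The factor `4 / 3` matches the covering radius `3 / (4 * (n + 1))`, which thus lies below `1 /
(1 + z n)`. -/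
lemma eventually_linear_bounds {z : ℕ → ℝ}
    (hz : Tendsto (fun n : ℕ => z n / ((n : ℝ) + 1)) atTop (𝓝 1)) :
    ∀ᶠ n : ℕ in atTop, (n : ℝ) + 1 ≤ 2 * (1 + z n) ∧ 1 + z n ≤ 4 / 3 * ((n : ℝ) + 1) := by
  filter_upwards [hz.eventually_const_lt (by norm_num : (1 / 2 : ℝ) < 1),
    hz.eventually_lt_const (by norm_num : (1 : ℝ) < 7 / 6), eventually_ge_atTop 6] with n h1 h2 h3
  have h3' : (6 : ℝ) ≤ n := by exact_mod_cast h3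
  rw [lt_div_iff₀ (by positivity)] at h1
  rw [div_lt_iff₀ (by positivity)] at h2
  constructor <;> linarith

lemma tendsto_one_add_atTop {z : ℕ → ℝ}
    (hz : Tendsto (fun n : ℕ => z n / ((n : ℝ) + 1)) atTop (𝓝 1)) :
    Tendsto (fun n => 1 + z n) atTop atTop := by
  refine tendsto_atTop_mono' atTop ?_
    (tendsto_natCast_add_one_atTop.atTop_div_const (by norm_num : (0 : ℝ) < 2))
  filter_upwards [eventually_linear_bounds hz] with n hn
  linarith [hn.1]

lemma summable_one_add_rpow_neg {z : ℕ → ℝ} (hz0 : ∀ n, 0 ≤ z n)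
    (hz : Tendsto (fun n : ℕ => z n / ((n : ℝ) + 1)) atTop (𝓝 1)) {p : ℝ} (hp : 1 < p) :
    Summable fun n => (1 + z n) ^ (-p) := by
  obtain ⟨p', hp', hpp'⟩ := exists_between hp
  refine Summable.of_norm_bounded_eventually_nat (summable_add_one_rpow_neg hp') ?_
  filter_upwards [eventually_rpow_le_rpow_of_linear_bound (x := fun n : ℕ => (n : ℝ) + 1)
    (fun n => by positivity) (tendsto_one_add_atTop hz)
    ((eventually_linear_bounds hz).mono fun n h => h.1) (by linarith : 0 ≤ p') hpp'] with n hn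
  have h1 : 0 < 1 + z n := by linarith [hz0 n]
  rw [Real.norm_of_nonneg (by positivity), Real.rpow_neg h1.le, Real.rpow_neg (by positivity)]
  exact inv_anti₀ (by positivity) hn

/-- The integral equation along one realisation of the points: the solution is nonnegative and
is the sum of its jumps. -/
lemma isJumpSeries_of_integral_eq {f : I → ℝ} {τ : ℕ → I} {z : ℕ → ℝ} {γ : ℝ → ℝ}
    (hγ : IsAdmissibleIndex γ) (hz0 : ∀ n, 0 ≤ z n)
    (hz : Tendsto (fun n : ℕ => z n / ((n : ℝ) + 1)) atTop (𝓝 1))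
    (hf : ∀ t : I, f t = ∫ p in Ioc 0 t ×ˢ Ici (0 : ℝ),
      jumpSize (γ (Function.leftLim f p.1)) p.2 ∂(Measure.sum fun n => Measure.dirac (τ n, z n))) :
    (∀ t, 0 ≤ f t) ∧ IsJumpSeries f τ fun n => jumpSize (γ (Function.leftLim f (τ n))) (z n) := by
  have hmeas : ∀ t : I, MeasurableSet (Ioc 0 t ×ˢ Ici (0 : ℝ)) := fun t =>
    measurableSet_Ioc.prod measurableSet_Ici
  -- Needed before anything else: the bounds on `γ` hold only on `[0,∞)`, where the left limits must
  -- be shown to lie.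
  have hnonneg : ∀ t, 0 ≤ f t := by
    intro t
    rw [hf t]
    exact setIntegral_nonneg (hmeas t) fun p hp => (jumpSize_pos hp.2).le
  refine ⟨hnonneg, fun t => ?_⟩
  obtain ⟨⟨ε, hε, hmaps⟩, -, -⟩ := hγ
  have hε1 : 0 < 1 - ε := by
    have := hmaps (mem_Ici.2 le_rfl)
    linarith [this.1, this.2]
  set F : I × ℝ → ℝ := fun p => jumpSize (γ (Function.leftLim f p.1)) p.2 with hF
  have hval : ∀ n, (Ioc 0 t ×ˢ Ici (0 : ℝ)).indicator F (τ n, z n) =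
      (Ioc (0 : I) t).indicator (fun _ => F (τ n, z n)) (τ n) := by
    intro n
    by_cases hn : τ n ∈ Ioc 0 t
    · rw [indicator_of_mem hn, indicator_of_mem (mk_mem_prod hn (mem_Ici.2 (hz0 n)))]
    · rw [indicator_of_notMem hn, indicator_of_notMem fun h => hn h.1]
  -- Since `γ ≤ 1 - ε`, every jump is at most `(1 + z n) ^ (-1 / (1 - ε))`, with an exponent beyond
  -- `1`.
  have hsumm : Summable fun n => (1 : ℝ≥0∞).toReal *
      ‖(Ioc 0 t ×ˢ Ici (0 : ℝ)).indicator F (τ n, z n)‖ := by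
    refine Summable.of_nonneg_of_le (fun n => by positivity) (fun n => ?_)
      (summable_one_add_rpow_neg hz0 hz (p := (1 - ε)⁻¹) ((one_lt_inv₀ hε1).2 (by linarith)))
    rw [ENNReal.toReal_one, one_mul]
    refine (norm_indicator_le_norm_self _ _).trans ?_
    have hm := hmaps (mem_Ici.2 (leftLim_nonneg hnonneg (τ n)))
    rw [Real.norm_of_nonneg (jumpSize_pos (hz0 n)).le]
    simp only [jumpSize]
    refine Real.rpow_le_rpow_of_exponent_le (by linarith [hz0 n]) ?_
    rw [neg_div, neg_le_neg_iff, one_div]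
    exact inv_anti₀ (hε.trans_le hm.1) hm.2
  have hs := hasSum_integral_sum_dirac (x := fun n => (τ n, z n)) (fun _ => ENNReal.one_ne_top) hsumm
  rw [hf t, ← integral_indicator (hmeas t)]
  simpa only [one_smul, ENNReal.toReal_one, one_mul, hval] using hs

/-! ### Pointwise exponents of a solution -/

section Exponent

variable {f : I → ℝ} {τ : ℕ → I} {z : ℕ → ℝ} {γ : ℝ → ℝ}

lemma tendsto_inv_index_leftLim (hγ : IsAdmissibleIndex γ) (hf0 : ∀ t, 0 ≤ f t)
    (hmono : Monotone f) {t : I} (ht : ContinuousAt f t) :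
    Tendsto (fun s => (γ (Function.leftLim f s))⁻¹) (𝓝 t) (𝓝 (γ (f t))⁻¹) := by
  obtain ⟨⟨ε, hε, hmaps⟩, ⟨K, hK⟩, -⟩ := hγ
  have hpos : 0 < γ (f t) := hε.trans_le (hmaps (mem_Ici.2 (hf0 t))).1
  have hc : Tendsto γ (𝓝[Ici 0] (f t)) (𝓝 (γ (f t))) :=
    hK.continuousOn.continuousWithinAt (mem_Ici.2 (hf0 t))
  refine (hc.comp (tendsto_nhdsWithin_iff.2
    ⟨tendsto_leftLim_of_continuousAt hmono ht, ?_⟩)).inv₀ hpos.ne'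
  exact Eventually.of_forall fun s => leftLim_nonneg hf0 s

/-- Otherwise choose `b` between `1/γ(f t)` and `α * δ`. Jumps near `t` are at least `(1 + z n) ^
(-b)`, yet at the approximating times regularity caps them by a multiple of `(1 + z n) ^ (-(α *
δ))`, which is impossible for large `n`. -/
lemma InPointwiseHolder.mul_le_inv_index (hγ : IsAdmissibleIndex γ) (hf0 : ∀ t, 0 ≤ f t)
    (hf : IsJumpSeries f τ fun n => jumpSize (γ (Function.leftLim f (τ n))) (z n))
    (hz0 : ∀ n, 0 ≤ z n) (hzlim : Tendsto (fun n => 1 + z n) atTop atTop) (hτ : ∀ n, τ n ≠ 0)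
    {t : I} (ht : ContinuousAt f t) {α δ : ℝ} (hα : 0 < α) (hδ : 0 < δ)
    (happ : ∃ᶠ n in atTop, dist (τ n) t < (1 + z n) ^ (-δ)) (h : InPointwiseHolder f α t) :
    α * δ ≤ (γ (f t))⁻¹ := by
  by_contra! hlt
  obtain ⟨b, hb1, hb2⟩ := exists_between hlt
  have hJ : ∀ n, 0 ≤ jumpSize (γ (Function.leftLim f (τ n))) (z n) :=
    fun n => (jumpSize_pos (hz0 n)).le
  obtain ⟨C, hC⟩ := h.exists_sub_leftLim_le (hf.monotone hJ) hα
  obtain ⟨r, hr, hball⟩ := Metric.mem_nhds_iff.1 (hC.and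
    ((tendsto_inv_index_leftLim hγ hf0 (hf.monotone hJ) ht).eventually_lt_const hb1))
  have hsmall := ((tendsto_rpow_neg_atTop hδ).comp hzlim).eventually_lt_const hr
  have hlarge := ((tendsto_rpow_atTop (sub_pos.2 hb2)).comp hzlim).eventually_gt_atTop |C|
  obtain ⟨n, hn1, hn2, hn3⟩ := (happ.and_eventually (hsmall.and hlarge)).exists
  simp only [Function.comp_apply] at hn2 hn3
  obtain ⟨h1, h2⟩ := hball (show τ n ∈ Metric.ball t r from hn1.trans hn2)
  have hz1 : 1 ≤ 1 + z n := by linarith [hz0 n]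
  have hzp : 0 < 1 + z n := by linarith
  have h3 := hf.leftLim_add_le hJ (hτ n)
  have h4 : (1 + z n) ^ (-b) ≤ jumpSize (γ (Function.leftLim f (τ n))) (z n) := by
    refine Real.rpow_le_rpow_of_exponent_le hz1 ?_
    rw [neg_div, one_div]
    linarith
  have h5 : |((τ n : ℝ)) - t| ^ α ≤ (1 + z n) ^ (-(α * δ)) := by
    have : (1 + z n) ^ (-(α * δ)) = ((1 + z n) ^ (-δ)) ^ α := by
      rw [← Real.rpow_mul hzp.le]; ring_nf
    rw [this]
    exact Real.rpow_le_rpow (abs_nonneg _) hn1.le hα.le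
  have h6 : (1 + z n) ^ (-b) ≤ |C| * (1 + z n) ^ (-(α * δ)) := by
    calc (1 + z n) ^ (-b) ≤ C * |((τ n : ℝ)) - t| ^ α := by linarith
      _ ≤ |C| * |((τ n : ℝ)) - t| ^ α := by gcongr; exact le_abs_self C
      _ ≤ _ := by gcongr
  have h7 : (1 + z n) ^ (-b) = (1 + z n) ^ (α * δ - b) * (1 + z n) ^ (-(α * δ)) := by
    rw [← Real.rpow_add hzp]; ring_nf
  rw [h7] at h6
  exact absurd (le_of_mul_le_mul_right h6 (by positivity)) (not_le.2 hn3)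

lemma inPointwiseHolder_of_lt (hγ : IsAdmissibleIndex γ) (hf0 : ∀ t, 0 ≤ f t)
    (hf : IsJumpSeries f τ fun n => jumpSize (γ (Function.leftLim f (τ n))) (z n))
    (hz0 : ∀ n, 0 ≤ z n) (hz : Tendsto (fun n : ℕ => z n / ((n : ℝ) + 1)) atTop (𝓝 1))
    (hctrl : ∀ q β η : ℚ, 0 < q → q ≤ 1 → 1 < β → 0 < η → HasUniformJumpControl τ q β η)
    {t : I} (ht : ContinuousAt f t) (hτ : ∀ n, τ n ≠ t) {α d : ℝ} (hα : 0 < α) (hd : 1 ≤ d)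
    (hαd : α * d < (γ (f t))⁻¹)
    (happ : ∀ δ, d < δ → ∀ᶠ n in atTop, (1 + z n) ^ (-δ) ≤ dist (τ n) t) :
    InPointwiseHolder f α t := by
  have hd0 : 0 < d := by linarith
  have hg1 : 1 < (γ (f t))⁻¹ := by
    obtain ⟨⟨ε, hε, hmaps⟩, -, -⟩ := hγ
    have hm := hmaps (mem_Ici.2 (hf0 t))
    exact (one_lt_inv₀ (hε.trans_le hm.1)).2 (by linarith [hm.2])
  set G := (γ (f t))⁻¹ with hG
  have hG0 : 0 < G := by linarith
  -- With `G = 1/γ(f t)`, the parameters satisfy `α/G < q < 1/d`, `max 1 (α/q) < β`, `β + η < b < G`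
  -- and `d < δ < 1/q`. The first three are rational because the control is available only for
  -- countably many triples.
  obtain ⟨q, hq1, hq2⟩ := exists_rat_btwn (show α / G < d⁻¹ by
    rw [div_lt_iff₀ hG0, inv_mul_eq_div, lt_div_iff₀ hd0]; exact hαd)
  have hq0 : (0 : ℝ) < q := lt_trans (by positivity) hq1
  have hqle : (q : ℝ) ≤ 1 := hq2.le.trans (inv_le_one_of_one_le₀ hd)
  obtain ⟨β, hβ1, hβ2⟩ := exists_rat_btwn (show max 1 (α / q) < G from
    max_lt hg1 (by rw [div_lt_iff₀ hq0, mul_comm]; exact (div_lt_iff₀ hG0).1 hq1))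
  obtain ⟨hβ3, hβ4⟩ := max_lt_iff.1 hβ1
  obtain ⟨η, hη1, hη2⟩ := exists_rat_btwn (sub_pos.2 hβ2)
  obtain ⟨b, hb1, hb2⟩ := exists_between (show (β : ℝ) + η < G by linarith)
  obtain ⟨δ, hδ1, hδ2⟩ := exists_between (show d < (q : ℝ)⁻¹ from
    (lt_inv_comm₀ hq0 hd0).1 hq2)
  have hJ : ∀ n, 0 ≤ jumpSize (γ (Function.leftLim f (τ n))) (z n) :=
    fun n => (jumpSize_pos (hz0 n)).le
  have hfar : ∀ᶠ n : ℕ in atTop, ((n : ℝ) + 1) ^ (-(q : ℝ)⁻¹) ≤ |(τ n : ℝ) - t| := by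
    filter_upwards [happ δ hδ1, eventually_rpow_le_rpow_of_linear_bound (x := fun n => 1 + z n)
      (fun n => by linarith [hz0 n]) tendsto_natCast_add_one_atTop
      ((eventually_linear_bounds hz).mono fun n h => h.2) (by linarith : 0 ≤ δ) hδ2] with n h1 h2
    refine le_trans ?_ h1
    have hzp : 0 < 1 + z n := by linarith [hz0 n]
    rw [Real.rpow_neg hzp.le, Real.rpow_neg (by positivity)]
    exact inv_anti₀ (by positivity) h2
  have hsize : ∀ᶠ n : ℕ in atTop, τ n ∈ {s | b < (γ (Function.leftLim f s))⁻¹} →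
      jumpSize (γ (Function.leftLim f (τ n))) (z n) ≤ ((n : ℝ) + 1) ^ (-((β : ℝ) + η)) := by
    filter_upwards [eventually_rpow_le_rpow_of_linear_bound (x := fun n : ℕ => (n : ℝ) + 1)
      (fun n => by positivity) (tendsto_one_add_atTop hz)
      ((eventually_linear_bounds hz).mono fun n h => h.1)
      (by linarith : 0 ≤ (β : ℝ) + η) hb1] with n h1 h2
    have h2' : b < (γ (Function.leftLim f (τ n)))⁻¹ := h2
    have hzp : 0 < 1 + z n := by linarith [hz0 n]
    calc jumpSize (γ (Function.leftLim f (τ n))) (z n) ≤ (1 + z n) ^ (-b) := by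
          refine Real.rpow_le_rpow_of_exponent_le (by linarith [hz0 n]) ?_
          rw [neg_div, one_div]
          linarith
      _ ≤ _ := by
          rw [Real.rpow_neg hzp.le, Real.rpow_neg (by positivity)]
          exact inv_anti₀ (by positivity) h1
  obtain ⟨C, hC, hev⟩ := (hctrl q β η (by exact_mod_cast hq0) (by exact_mod_cast hqle)
    (by exact_mod_cast hβ3) (by exact_mod_cast hη1)).exists_abs_sub_le hf hJ hq0 hα
    ((div_lt_iff₀ hq0).1 hβ4) hτ hfar
    ((tendsto_inv_index_leftLim hγ hf0 (hf.monotone hJ) ht).eventually_const_lt hb2) hsize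
  -- A constant polynomial suffices, even when `α > 1`.
  exact ⟨C, hC, Polynomial.C (f t), by simpa using hα, by simpa using hev⟩

end Exponent

lemma mem_approxSet_iff {Ω : Type*} {T : ℕ → Ω → I} {Y : ℕ → Ω → ℝ} {ω : Ω} {δ : ℝ} {t : I} :
    t ∈ approxSet T Y ω δ ↔
      ∃ᶠ n in atTop, dist (T n ω) t < (1 + poissonHeight Y n ω) ^ (-δ) := by
  simp [approxSet, frequently_atTop, dist_comm]

theorem theorem3 {Ω : Type*} [MeasurableSpace Ω] (P : Measure Ω) [IsProbabilityMeasure P]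
    (T : ℕ → Ω → I) (Y : ℕ → Ω → ℝ) (hTY : IsPoissonInput P T Y)
    (γ : ℝ → ℝ) (hγ : IsAdmissibleIndex γ)
    (M : I → Ω → ℝ) (hM : IsJumpSDESolution P T Y γ M) :
    ∀ᵐ ω ∂P,
      (∀ t : I, t ∉ jumpTimes (fun s => M s ω) →
        pointwiseHolderExponent (fun s => M s ω) t =
          1 / (approxRate T Y ω t * ENNReal.ofReal (γ (M t ω)))) ∧
      (∀ t : I, pointwiseHolderExponent (fun s => M s ω) t ≤ 1 / ENNReal.ofReal (γ (M t ω))) := by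
  have hctrl : ∀ᵐ ω ∂P, ∀ q β η : ℚ, 0 < q → q ≤ 1 → 1 < β → 0 < η →
      HasUniformJumpControl (fun n => T n ω) q β η := by
    refine ae_all_iff.2 fun q => ae_all_iff.2 fun β => ae_all_iff.2 fun η => ?_
    by_cases h : 0 < q ∧ q ≤ 1 ∧ 1 < β ∧ 0 < η
    · obtain ⟨h1, h2, h3, h4⟩ := h
      filter_upwards [hTY.ae_hasUniformJumpControl (q := q) (β := β) (η := η)
        (by exact_mod_cast h1) (by exact_mod_cast h2) (by exact_mod_cast h3)
        (by exact_mod_cast h4)] with ω hω _ _ _ _ using hω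
    · exact Eventually.of_forall fun ω h1 h2 h3 h4 => absurd ⟨h1, h2, h3, h4⟩ h
  filter_upwards [hctrl, hM.cadlag, hM.sde, hTY.ae_poissonHeight_nonneg,
    hTY.ae_tendsto_poissonHeight_div, hTY.ae_ne 0, hTY.ae_forall_frequently_dist_lt]
    with ω hctrl hcad hsde hz0 hz hτ hcov
  set f : I → ℝ := fun s => M s ω with hfdef
  obtain ⟨hf0, hf⟩ := isJumpSeries_of_integral_eq (f := f) (τ := fun n => T n ω)
    (z := fun n => poissonHeight Y n ω) hγ hz0 hz hsde
  have hJpos : ∀ n, 0 < jumpSize (γ (Function.leftLim f (T n ω))) (poissonHeight Y n ω) :=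
    fun n => jumpSize_pos (hz0 n)
  have hmono := hf.monotone fun n => (hJpos n).le
  have hgpos : ∀ t, 0 < γ (f t) := by
    obtain ⟨⟨ε, hε, hmaps⟩, -, -⟩ := hγ
    exact fun t => hε.trans_le (hmaps (mem_Ici.2 (hf0 t))).1
  have hrate : ∀ t, 1 ≤ approxRate T Y ω t := by
    intro t
    have hmem : t ∈ approxSet T Y ω 1 := by
      rw [mem_approxSet_iff]
      refine ((hcov t).and_eventually (eventually_linear_bounds hz)).mono fun n hn => ?_
      have hzp : 0 < 1 + poissonHeight Y n ω := by linarith [hz0 n]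
      refine hn.1.trans_le ?_
      rw [Real.rpow_neg_one, ← one_div, div_le_div_iff₀ (by positivity) hzp]
      linarith [hn.2.2]
    have h1 := le_iSup₂ (f := fun (δ : ℝ) (_ : δ ∈ {δ : ℝ | 1 ≤ δ ∧ t ∈ approxSet T Y ω δ}) =>
      ENNReal.ofReal δ) 1 ⟨le_rfl, hmem⟩
    simpa [approxRate] using h1
  have hmain : ∀ t, t ∉ jumpTimes f → pointwiseHolderExponent f t =
      1 / (approxRate T Y ω t * ENNReal.ofReal (γ (f t))) := by
    intro t htJ
    have hcont := continuousAt_of_notMem_jumpTimes hmono (hcad t).1 htJ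
    -- All jumps are strictly positive, so every `Tₙ` is a jump time.
    have hτt : ∀ n, T n ω ≠ t := by
      rintro n rfl
      have h1 := hf.leftLim_add_le (fun n => (hJpos n).le) (hτ n)
      have h2 := hJpos n
      simp only [jumpTimes, mem_ofPred_eq, not_not] at htJ
      linarith
    have hg0 : ENNReal.ofReal (γ (f t)) ≠ 0 := by simpa using hgpos t
    refine le_antisymm ?_ ?_
    · refine iSup₂_le fun α hα => ?_
      rw [ENNReal.le_div_iff_mul_le (Or.inr one_ne_zero) (Or.inr ENNReal.one_ne_top),
        approxRate, ENNReal.iSup_mul, ENNReal.mul_iSup]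
      refine iSup_le fun δ => ?_
      rw [ENNReal.iSup_mul, ENNReal.mul_iSup]
      refine iSup_le fun hδ => ?_
      have hδ0 : 0 < δ := by linarith [hδ.1]
      have h1 := hα.2.mul_le_inv_index hγ hf0 hf hz0 (tendsto_one_add_atTop hz) hτ hcont hα.1
        hδ0 (mem_approxSet_iff.1 hδ.2)
      rw [← ENNReal.ofReal_mul hδ0.le, ← ENNReal.ofReal_mul hα.1.le, ← ENNReal.ofReal_one]
      refine ENNReal.ofReal_le_ofReal ?_
      rw [← mul_assoc, ← le_div_iff₀ (hgpos t), one_div]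
      exact h1
    · rcases eq_or_ne (approxRate T Y ω t) ∞ with htop | htop
      · rw [htop, ENNReal.top_mul hg0]
        simp
      set d : ℝ := (approxRate T Y ω t).toReal with hd
      have hd1 : 1 ≤ d := by
        have := ENNReal.toReal_mono htop (hrate t)
        simpa using this
      have hd0 : 0 < d := by linarith
      have heq : 1 / (approxRate T Y ω t * ENNReal.ofReal (γ (f t))) =
          ENNReal.ofReal (1 / (d * γ (f t))) := by
        rw [← ENNReal.ofReal_toReal htop, ← hd, ← ENNReal.ofReal_mul hd0.le,
          ENNReal.ofReal_div_of_pos (mul_pos hd0 (hgpos t)), ENNReal.ofReal_one]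
      have happ : ∀ δ, d < δ → ∀ᶠ n in atTop,
          (1 + poissonHeight Y n ω) ^ (-δ) ≤ dist (T n ω) t := by
        intro δ hδ
        by_contra hcon
        have hmem : t ∈ approxSet T Y ω δ := by
          rw [mem_approxSet_iff]
          exact (not_eventually.1 hcon).mono fun n hn => not_le.1 hn
        have h1 : ENNReal.ofReal δ ≤ approxRate T Y ω t :=
          le_iSup₂ (f := fun (δ : ℝ) (_ : δ ∈ {δ : ℝ | 1 ≤ δ ∧ t ∈ approxSet T Y ω δ}) =>
            ENNReal.ofReal δ) δ ⟨hd1.trans hδ.le, hmem⟩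
        have h2 := (ENNReal.ofReal_le_iff_le_toReal htop).1 h1
        linarith
      rw [heq]
      refine le_of_forall_lt fun a ha => ?_
      -- The intermediate `a'` is finite and positive even if `a = 0`, so it is an admissible Hölder
      -- order.
      obtain ⟨a', haa', ha'⟩ := exists_between ha
      have ha'top : a' ≠ ∞ := ha'.ne_top
      have ha'0 : 0 < a'.toReal := ENNReal.toReal_pos (bot_le.trans_lt haa').ne' ha'top
      have hlt : a'.toReal < 1 / (d * γ (f t)) := (ENNReal.lt_ofReal_iff_toReal_lt ha'top).1 ha'
      have hholder : InPointwiseHolder f a'.toReal t := by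
        refine inPointwiseHolder_of_lt hγ hf0 hf hz0 hz hctrl hcont hτt ha'0 hd1 ?_ happ
        rw [lt_div_iff₀ (mul_pos hd0 (hgpos t))] at hlt
        rw [← one_div, lt_div_iff₀ (hgpos t)]
        linarith
      refine haa'.trans_le ?_
      have h1 : ENNReal.ofReal a'.toReal ≤ pointwiseHolderExponent f t :=
        le_iSup₂ (f := fun (α : ℝ) (_ : α ∈ {α : ℝ | 0 < α ∧ InPointwiseHolder f α t}) =>
          ENNReal.ofReal α) a'.toReal ⟨ha'0, hholder⟩
      rwa [ENNReal.ofReal_toReal ha'top] at h1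
  refine ⟨hmain, fun t => ?_⟩
  by_cases htJ : t ∈ jumpTimes f
  · refine iSup₂_le fun α hα => ?_
    exact absurd htJ (hα.2.notMem_jumpTimes hmono hα.1)
  · have h1 := hmain t htJ
    rw [h1]
    exact ENNReal.div_le_div_left (le_mul_of_one_le_left' (hrate t)) 1
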